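/- All Hilbert spaces are complex and operators are bounded; $|A|=(A^*A)^{1/2}$. For Hilbert spaces $\mathcal H\subseteq\mathcal K$ (isometric embedding), $A\subseteq B$ means that $B\in\boldsymbol B(\mathcal K)$ extends $A\in\boldsymbol B(\mathcal H)$. An operator $S\in\boldsymbol B(\mathcal H)$ is *subnormal* if it has a normal extension $N\in\boldsymbol B(\mathcal K)$ on some Hilbert space $\mathcal K\supseteq\mathcal H$, and *quasinormal* if $SS^*S=S^*SS$. We write $N=\mathrm{mne}\,S$ if $N\in\boldsymbol B(\mathcal K)$ is a normal extension of $S$ and $\mathcal K$ is the only closed subspace of $\mathcal K$ containing $\mathcal H$ and reducing $N$. Let $\mathscr U,\mathscr I,\mathscr N,\mathscr Q,\mathscr S$ be the classes of unitary, isometric, normal, quasinormal and subnormal operators. For $\mathscr X$ one of these classes and nonzero Hilbert spaces $\mathcal H_1,\mathcal H_2$, write $\begin{bmatrix}V&E\\0&X\end{bmatrix}\in\mathscr X_{\mathcal H_1,\mathcal H_2}$ if $V\in\boldsymbol B(\mathcal H_1)$, $E\in\boldsymbol B(\mathcal H_2,\mathcal H_1)$, $X\in\boldsymbol B(\mathcal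 H_2)$ satisfy $V^*V=I$, $V^*E=0$, $XE^*E=E^*EX$ and $X\in\mathscr X$. For operators $[A_{ij}]$ on $\mathcal H_1\oplus\mathcal H_2$ and $[\tilde A_{ij}]$ on $\mathcal K_1\oplus\mathcal K_2$, write $[A_{ij}]\preceq[\tilde A_{ij}]$ if $\mathcal H_j\subseteq\mathcal K_j$ (isometric embeddings) and $A_{ij}h_j=\tilde A_{ij}h_j$ for all $h_j\in\mathcal H_j$, $i,j=1,2$. **Proposition.** Let $T=\begin{bmatrix}V&E\\0&S\end{bmatrix}\in\mathscr S_{\mathcal H_1,\mathcal H_2}$, $R=\begin{bmatrix}\tilde V&\tilde E\\0&N\end{bmatrix}\in\mathscr N_{\mathcal K_1,\mathcal K_2}$ and $T\preceq R$. Fix an integer $n\ge1$ and set $E_n=\sum_{j=0}^{n-1}V^jES^{n-1-j}$ and $\tilde E_n=\sum_{j=0}^{n-1}\tilde V^j\tilde EN^{n-1-j}$. Then: (i) $T^n=\begin{bmatrix}V^n&E_n\\0&S^n\end{bmatrix}$, $R^n=\begin{bmatrix}\tilde V^n&\tilde E_n\\0&N^n\end{bmatrix}$, $T^n\preceq R^n$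 and $R^n\in\mathscr N_{\mathcal K_1,\mathcal K_2}$. (ii) If $|E|\subseteq|\tilde E|$, then $E_n^*E_n=P\tilde E_n^*\tilde E_n|_{\mathcal H_2}$, where $P\in\boldsymbol B(\mathcal K_2)$ is the orthogonal projection of $\mathcal K_2$ onto $\mathcal H_2$. (iii) If $N=\mathrm{mne}\,S$, then $N^n=\mathrm{mne}\,S^n$. (iv) If $T\in\mathscr Q_{\mathcal H_1,\mathcal H_2}$ and $|E|\subseteq|\tilde E|$, then $T^n\in\mathscr Q_{\mathcal H_1,\mathcal H_2}$, $T^n\preceq R^n\in\mathscr N_{\mathcal K_1,\mathcal K_2}$ and $|E_n|\subseteq|\tilde E_n|$. (v) If $T\in\mathscr I_{\mathcal H_1,\mathcal H_2}$ and $N=\mathrm{mne}\,S$, then $R^n\in\mathscr U_{\mathcal K_1,\mathcal K_2}$ and $N^n=\mathrm{mne}\,S^n$. -/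

import Mathlib

namespace Brownian

open ContinuousLinearMap

universe u v w

section Basic

variable {H : Type u} [NormedAddCommGroup H] [InnerProductSpace ℂ H] [CompleteSpace H]
variable {K : Type v} [NormedAddCommGroup K] [InnerProductSpace ℂ K] [CompleteSpace K]

/-- The modulus `|E| = (E* E)^(1/2)` of a bounded operator `E : H → K`; it acts on `H`. -/
noncomputable def modulus (E : H →L[ℂ] K) : H →L[ℂ] H :=
  CFC.sqrt (adjoint E ∘L E)

/-- `B` extends `A`, where the inclusion of the space `H` in the space `K` is the
isometric embedding `J`. -/
def Extends (J : H →ₗᵢ[ℂ] K) (A : H →L[ℂ] H) (B : K →L[ℂ] K) : Prop :=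
  ∀ h : H, B (J h) = J (A h)

/-- The isometric copy of `H` in `K` is complete, so that it has an orthogonal projection. -/
instance hasOrthogonalProjection_range (J : H →ₗᵢ[ℂ] K) :
    (LinearMap.range J.toLinearMap).HasOrthogonalProjection := by
  have : CompleteSpace (LinearMap.range J.toLinearMap) := by
    rw [LinearMap.range_eq_map]
    have : CompleteSpace (⊤ : Submodule ℂ H) := isClosed_univ.completeSpace_coe
    exact J.completeSpace_map ⊤
  infer_instance

/-- The orthogonal projection of `K` onto (the isometric copy of) `H`, as an operator on `K`. -/
noncomputable def projOnto (J : H →ₗᵢ[ℂ] K) : K →L[ℂ] K :=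
  (LinearMap.range J.toLinearMap).starProjection

/-- The subspace `M` reduces `A`: both `M` and its orthogonal complement are invariant for `A`. -/
def Reduces (M : Submodule ℂ H) (A : H →L[ℂ] H) : Prop :=
  (∀ x ∈ M, A x ∈ M) ∧ (∀ x ∈ Mᗮ, A x ∈ Mᗮ)

/-- `N` is a minimal normal extension of `S` (written `N = mne S`): a normal extension
such that the whole space `K` is the only closed subspace that contains `H` and reduces `N`. -/
def IsMinNormalExt (J : H →ₗᵢ[ℂ] K) (S : H →L[ℂ] H) (N : K →L[ℂ] K) : Prop :=
  IsStarNormal N ∧ Extends J S N ∧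
    ∀ M : Submodule ℂ K, IsClosed (M : Set K) → LinearMap.range J.toLinearMap ≤ M →
      Reduces M N → M = ⊤

/-- Unitary operators. -/
def IsUnitaryOp (A : H →L[ℂ] H) : Prop := adjoint A ∘L A = 1 ∧ A ∘L adjoint A = 1

/-- Isometric operators. -/
def IsIsometricOp (A : H →L[ℂ] H) : Prop := adjoint A ∘L A = 1

/-- Normal operators. -/
def IsNormalOp (A : H →L[ℂ] H) : Prop := IsStarNormal A

/-- Quasinormal operators: `A A* A = A* A A`. -/
def IsQuasinormalOp (A : H →L[ℂ] H) : Prop :=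
  A ∘L adjoint A ∘L A = adjoint A ∘L A ∘L A

/-- Subnormal operators: those with a normal extension on some complex Hilbert space. (A normal
extension can always be cut down to a minimal one, and this acts on a space that has a copy
in the universe of `H`.) -/
def IsSubnormalOp (S : H →L[ℂ] H) : Prop :=
  ∃ (L : Type u) (_ : NormedAddCommGroup L) (_ : InnerProductSpace ℂ L) (_ : CompleteSpace L)
    (J : H →ₗᵢ[ℂ] L) (N : L →L[ℂ] L), IsStarNormal N ∧ Extends J S N

end Basic

section Block

variable {H₁ : Type u} [NormedAddCommGroup H₁] [InnerProductSpace ℂ H₁] [CompleteSpace H₁]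
variable {H₂ : Type v} [NormedAddCommGroup H₂] [InnerProductSpace ℂ H₂] [CompleteSpace H₂]

/-- The operator on the Hilbert space direct sum `H₁ ⊕ H₂` with the block matrix
`[A₁₁ A₁₂; A₂₁ A₂₂]`. -/
noncomputable def block (A₁₁ : H₁ →L[ℂ] H₁) (A₁₂ : H₂ →L[ℂ] H₁)
    (A₂₁ : H₁ →L[ℂ] H₂) (A₂₂ : H₂ →L[ℂ] H₂) :
    WithLp 2 (H₁ × H₂) →L[ℂ] WithLp 2 (H₁ × H₂) :=
  (WithLp.prodContinuousLinearEquiv 2 ℂ H₁ H₂).symm.toContinuousLinearMap ∘L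
    ((A₁₁.coprod A₁₂).prod (A₂₁.coprod A₂₂)) ∘L
      (WithLp.prodContinuousLinearEquiv 2 ℂ H₁ H₂).toContinuousLinearMap

/-- The conditions on the entries `V`, `E`, `X` of a Brownian-type operator `[V E; 0 X]`
on `H₁ ⊕ H₂`. -/
structure IsBrownianType (V : H₁ →L[ℂ] H₁) (E : H₂ →L[ℂ] H₁) (X : H₂ →L[ℂ] H₂) : Prop where
  nontrivial_left : Nontrivial H₁
  nontrivial_right : Nontrivial H₂
  isometry : adjoint V ∘L V = 1
  adjoint_comp : adjoint V ∘L E = 0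
  comm : X ∘L (adjoint E ∘L E) = (adjoint E ∘L E) ∘L X

/-- `T` is a Brownian-type operator with respect to `H₁ ⊕ H₂` whose `(2,2)` entry belongs to
the class `𝒳` of operators on `H₂`. -/
def IsOfClass (𝒳 : (H₂ →L[ℂ] H₂) → Prop)
    (T : WithLp 2 (H₁ × H₂) →L[ℂ] WithLp 2 (H₁ × H₂)) : Prop :=
  ∃ (V : H₁ →L[ℂ] H₁) (E : H₂ →L[ℂ] H₁) (X : H₂ →L[ℂ] H₂),
    T = block V E 0 X ∧ IsBrownianType V E X ∧ 𝒳 X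

/-- The operator `∑_{j=0}^{n-1} V^j E S^(n-1-j)`. -/
noncomputable def powEntry (V : H₁ →L[ℂ] H₁) (E : H₂ →L[ℂ] H₁) (S : H₂ →L[ℂ] H₂) (n : ℕ) :
    H₂ →L[ℂ] H₁ :=
  ∑ j ∈ Finset.range n, (V ^ j) ∘L E ∘L (S ^ (n - 1 - j))

end Block

section Entrywise

universe u₁ u₂ v₁ v₂

variable {H₁ : Type u₁} [NormedAddCommGroup H₁] [InnerProductSpace ℂ H₁] [CompleteSpace H₁]
variable {H₂ : Type u₂} [NormedAddCommGroup H₂] [InnerProductSpace ℂ H₂] [CompleteSpace H₂]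
variable {K₁ : Type v₁} [NormedAddCommGroup K₁] [InnerProductSpace ℂ K₁] [CompleteSpace K₁]
variable {K₂ : Type v₂} [NormedAddCommGroup K₂] [InnerProductSpace ℂ K₂] [CompleteSpace K₂]

/-- `R` on `K₁ ⊕ K₂` is an entrywise extension of `T` on `H₁ ⊕ H₂`, where the inclusions of
`H₁` in `K₁` and of `H₂` in `K₂` are `J₁` and `J₂`: each entry of `R` extends the
corresponding entry of `T`. -/
def EntrywiseExtends (J₁ : H₁ →ₗᵢ[ℂ] K₁) (J₂ : H₂ →ₗᵢ[ℂ] K₂)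
    (T : WithLp 2 (H₁ × H₂) →L[ℂ] WithLp 2 (H₁ × H₂))
    (R : WithLp 2 (K₁ × K₂) →L[ℂ] WithLp 2 (K₁ × K₂)) : Prop :=
  ∃ (A₁₁ : H₁ →L[ℂ] H₁) (A₁₂ : H₂ →L[ℂ] H₁) (A₂₁ : H₁ →L[ℂ] H₂) (A₂₂ : H₂ →L[ℂ] H₂)
    (B₁₁ : K₁ →L[ℂ] K₁) (B₁₂ : K₂ →L[ℂ] K₁) (B₂₁ : K₁ →L[ℂ] K₂) (B₂₂ : K₂ →L[ℂ] K₂),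
    T = block A₁₁ A₁₂ A₂₁ A₂₂ ∧ R = block B₁₁ B₁₂ B₂₁ B₂₂ ∧
      (∀ h, B₁₁ (J₁ h) = J₁ (A₁₁ h)) ∧ (∀ h, B₁₂ (J₂ h) = J₁ (A₁₂ h)) ∧
      (∀ h, B₂₁ (J₁ h) = J₂ (A₂₁ h)) ∧ (∀ h, B₂₂ (J₂ h) = J₂ (A₂₂ h))

end Entrywise

end Brownian

namespace Brownian

set_option linter.unusedSectionVars false

open ContinuousLinearMap

/-! ### Reducing subspaces and powers of normal operators -/

section Operators

variable {H K : Type*} [NormedAddCommGroup H] [InnerProductSpace ℂ H] [CompleteSpace H]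
  [NormedAddCommGroup K] [InnerProductSpace ℂ K] [CompleteSpace K]

/-! Since `V` is isometric and `V* E = 0`, the two terms of `E_{n+1} = E X^n + V E_n` have
orthogonal ranges. If `X` is quasinormal, induction gives `E_n* E_n = ∑_{j<n} (X* X)^j E* E`, which
commutes with `X`; hence powers stay in the normal and quasinormal classes. For quasinormal `S`, `N*
N` extends `S* S`, so `Ẽ_n* Ẽ_n` extends `E_n* E_n` once `|Ẽ|` extends `|E|`, and square roots
preserve extension (`modulus_powEntry_extends`). The compression formula only uses `Ẽ_n J₂ = J₁
E_n`.

Minimality passes to powers by `reduces_of_reduces_pow`: if `M` contains `H` and reduces `N^n`, the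
largest `N`-invariant subspace of `M` reduces `N^n`, hence `N`, so it is the whole space. For
isometric `S`, minimality applied to the kernel of `N* N - 1` makes `N` unitary. -/

theorem commute_of_commute_pow {a b : H →L[ℂ] H} (ha : 0 ≤ a) {n : ℕ} (hn : n ≠ 0)
    (h : Commute (a ^ n) b) : Commute a b := by
  -- As `a ≥ 0`, the functional calculus recovers `a` as the `n`-th root of `a ^ n`.
  have hc := h.cfc_nnreal (fun x => x ^ ((n : ℝ)⁻¹))
  have : cfc (fun x : NNReal => x ^ ((n : ℝ)⁻¹)) (a ^ n) = a := by
    rw [← cfc_comp_pow (fun x : NNReal => x ^ ((n : ℝ)⁻¹)) n a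
      (NNReal.continuous_rpow_const (by positivity)).continuousOn]
    simp [NNReal.pow_rpow_inv_natCast _ hn, cfc_id' NNReal a]
  rwa [this] at hc

/-- A normal operator and its adjoint have the same kernel. So if `Y = N*^(m+1) D` satisfies `N* Y =
0`, then `N Y = 0`, and `Y* Y = (N*^m D)* N Y = 0`. -/
theorem star_mul_eq_zero_of_star_pow_mul_eq_zero {N D : H →L[ℂ] H} (hN : IsStarNormal N)
    (m : ℕ) (h : star N ^ (m + 1) * D = 0) : star N * D = 0 := by
  induction m with
  | zero => simpa using h
  | succ m ih =>
    apply ih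
    have hc : star N * N = N * star N := hN.star_comm_self
    have h₁ : star N * (star N ^ (m + 1) * D) = 0 := by
      rw [← mul_assoc, ← pow_succ', h]
    have h₂ : N * (star N ^ (m + 1) * D) = 0 := by
      rw [← CStarRing.star_mul_self_eq_zero_iff, star_mul, mul_assoc, ← mul_assoc (star N), hc,
        mul_assoc N, h₁, mul_zero, mul_zero]
    rw [← CStarRing.star_mul_self_eq_zero_iff]
    conv_lhs => lhs; rw [pow_succ', mul_assoc, star_mul, star_star]
    rw [mul_assoc, h₂, mul_zero]

/-- If a projection `Q` onto an invariant subspace of a normal operator `N` commutes with a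
power of `N`, then this subspace is also invariant for the adjoint of `N`. -/
theorem star_mul_proj_of_commute_pow {N Q : H →L[ℂ] H} (hN : IsStarNormal N)
    (hQ : star Q = Q) (hQQ : Q * Q = Q) (hNQ : Q * (N * Q) = N * Q) {n : ℕ} (hn : n ≠ 0)
    (hc : Commute Q (N ^ n)) : Q * (star N * Q) = star N * Q := by
  have hcN : star N * N = N * star N := hN.star_comm_self
  have hcN' : Commute (star N) N := hcN
  -- `Q` commutes with `N*^n N^n = (N* N)^n`, hence with its positive root `N* N`.
  have hC : Commute (star N * N) Q := by
    apply commute_of_commute_pow (star_mul_self_nonneg N) hn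
    rw [hcN'.mul_pow]
    have := hc.star_star
    rw [hQ, star_pow] at this
    exact this.symm.mul_left hc.symm
  obtain ⟨m, rfl⟩ := Nat.exists_eq_succ_of_ne_zero hn
  have hpow : ∀ k : ℕ, Q * (N ^ k * Q) = N ^ k * Q := by
    intro k
    induction k with
    | zero => simpa using hQQ
    | succ k ih =>
      rw [pow_succ', mul_assoc, ← ih, ← mul_assoc N, ← mul_assoc Q, hNQ]
  -- `F = (1 - Q) N* Q` is the obstruction to invariance under `N*`. It kills the range of
  -- `N^(m+1)`, so `N* F* = 0` by the kernel lemma; with `Q F* = F*` this yields `F F* = 0`.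
  set F := star N * Q - Q * (star N * Q) with hF
  have h₁ : F * N ^ (m + 1) = 0 := by
    have e : star N * Q * N ^ (m + 1) = N ^ m * Q * (star N * N) := by
      rw [mul_assoc, hc.eq, pow_succ, ← mul_assoc, ← mul_assoc, (hcN'.pow_right m).eq,
        mul_assoc, mul_assoc, ← mul_assoc (star N), hC.eq, mul_assoc]
    rw [hF, sub_mul, mul_assoc Q, e, ← mul_assoc Q, hpow, sub_self]
  have h₂ : star N ^ (m + 1) * star F = 0 := by
    have := congrArg star h₁
    rwa [star_mul, star_pow, star_zero] at this
  have h₃ := star_mul_eq_zero_of_star_pow_mul_eq_zero hN m h₂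
  have h₄ : Q * star F = star F := by
    simp only [hF, star_sub, star_mul, star_star, hQ, mul_sub]
    simp only [← mul_assoc, hQQ]
  have h₅ : F * star F = 0 := by
    conv_lhs => lhs; rw [hF]
    rw [sub_mul, mul_assoc Q, mul_assoc, h₄, h₃, mul_zero, sub_self]
  rw [CStarRing.mul_star_self_eq_zero_iff] at h₅
  exact (sub_eq_zero.mp h₅).symm

theorem reduces_iff {M : Submodule ℂ H} (hM : IsClosed (M : Set H)) (A : H →L[ℂ] H) :
    Reduces M A ↔ (∀ x ∈ M, A x ∈ M) ∧ ∀ x ∈ M, adjoint A x ∈ M := by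
  have : CompleteSpace M := hM.completeSpace_coe
  refine and_congr_right fun _ => ⟨fun h x hx => ?_, fun h x hx => ?_⟩
  · rw [← M.orthogonal_orthogonal, Submodule.mem_orthogonal]
    intro y hy
    rw [adjoint_inner_right]
    exact (Submodule.mem_orthogonal' _ _).1 (h y hy) x hx
  · rw [Submodule.mem_orthogonal]
    intro y hy
    rw [← adjoint_inner_left]
    exact (Submodule.mem_orthogonal _ _).1 hx _ (h y hy)

theorem starProjection_mul_eq_iff {M : Submodule ℂ H} [M.HasOrthogonalProjection]
    (A : H →L[ℂ] H) :
    M.starProjection * (A * M.starProjection) = A * M.starProjection ↔ ∀ x ∈ M, A x ∈ M := by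
  constructor
  · intro h x hx
    have := congrArg (fun B : H →L[ℂ] H => B x) h
    simp only [mul_apply_eq_comp,
      Submodule.starProjection_eq_self_iff.2 hx] at this
    exact Submodule.starProjection_eq_self_iff.1 this
  · intro h
    ext x
    exact Submodule.starProjection_eq_self_iff.2 (h _ (M.starProjection_apply_mem x))

/-- A closed invariant subspace of a normal operator which reduces a power of it reduces it. -/
theorem reduces_of_reduces_pow {M : Submodule ℂ H} (hM : IsClosed (M : Set H)) {N : H →L[ℂ] H}
    (hN : IsStarNormal N) (hinv : ∀ x ∈ M, N x ∈ M) {n : ℕ} (hn : n ≠ 0)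
    (hred : Reduces M (N ^ n)) : Reduces M N := by
  have : CompleteSpace M := hM.completeSpace_coe
  rw [reduces_iff hM] at hred ⊢
  refine ⟨hinv, ?_⟩
  have hQ : star M.starProjection = M.starProjection := (isSelfAdjoint_starProjection M).star_eq
  rw [← starProjection_mul_eq_iff, ← starProjection_mul_eq_iff] at hred
  rw [← starProjection_mul_eq_iff] at hinv ⊢
  refine star_mul_proj_of_commute_pow hN hQ M.isIdempotentElem_starProjection hinv hn ?_
  -- Adjoints turn invariance under `(N^n)*` into `Q N^n Q = Q N^n`, which combines with `Q N^n Q =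
  -- N^n Q`.
  have h := congrArg star hred.2
  rw [← star_eq_adjoint] at h
  simp only [star_mul, star_star, hQ] at h
  rw [mul_assoc, hred.1] at h
  exact h.symm

theorem Extends.pow {J : H →ₗᵢ[ℂ] K} {A : H →L[ℂ] H} {B : K →L[ℂ] K} (h : Extends J A B) (n : ℕ) :
    Extends J (A ^ n) (B ^ n) := by
  intro x
  induction n generalizing x with
  | zero => simp
  | succ n ih => simp only [pow_succ, mul_apply_eq_comp, h x, ih]

theorem isStarNormal_pow {N : H →L[ℂ] H} (hN : IsStarNormal N) (n : ℕ) : IsStarNormal (N ^ n) := by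
  refine ⟨?_⟩
  rw [star_pow]
  exact hN.star_comm_self.pow_pow n n

theorem IsMinNormalExt.pow {J : H →ₗᵢ[ℂ] K} {S : H →L[ℂ] H} {N : K →L[ℂ] K}
    (h : IsMinNormalExt J S N) {n : ℕ} (hn : n ≠ 0) : IsMinNormalExt J (S ^ n) (N ^ n) := by
  obtain ⟨hN, hext, hmin⟩ := h
  refine ⟨isStarNormal_pow hN n, hext.pow n, fun M hM hJ hred => ?_⟩
  rw [reduces_iff hM] at hred
  have hmem : ∀ x, x ∈ (⨅ k : ℕ, M.comap (N ^ k).toLinearMap) ↔ ∀ k : ℕ, (N ^ k) x ∈ M := by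
    intro x; simp only [Submodule.mem_iInf]; rfl
  -- The largest `N`-invariant subspace of `M`.
  set L : Submodule ℂ K := ⨅ k : ℕ, M.comap (N ^ k).toLinearMap
  have hLM : L ≤ M := fun x hx => by simpa using (hmem x).1 hx 0
  have hLc : IsClosed (L : Set K) := by
    have : (L : Set K) = ⋂ k : ℕ, (N ^ k) ⁻¹' (M : Set K) := by
      ext x; simpa using hmem x
    rw [this]
    exact isClosed_iInter fun k => hM.preimage (N ^ k).continuous
  have hcomm : ∀ (k : ℕ) (x : K), (N ^ k) (adjoint (N ^ n) x) = adjoint (N ^ n) ((N ^ k) x) := by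
    intro k x
    have : Commute (N ^ k) (star (N ^ n)) := by
      rw [star_pow]; exact hN.star_comm_self.symm.pow_pow k n
    exact congrArg (fun B : K →L[ℂ] K => B x) this.eq
  have hinv : ∀ x ∈ L, N x ∈ L := by
    intro x hx
    rw [hmem] at hx ⊢
    intro k
    simpa [pow_succ] using hx (k + 1)
  have hredL : Reduces L (N ^ n) := by
    rw [reduces_iff hLc]
    constructor <;> intro x hx <;> rw [hmem] at hx ⊢ <;> intro k
    · simpa [pow_add] using hx (k + n)
    · rw [hcomm]
      exact hred.2 _ (hx k)
  have htop : L = ⊤ := by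
    refine hmin L hLc ?_ (reduces_of_reduces_pow hLc hN hinv hn hredL)
    rintro _ ⟨x, rfl⟩
    rw [hmem]
    intro k
    exact hJ ⟨(S ^ k) x, ((hext.pow k) x).symm⟩
  exact top_le_iff.1 (htop ▸ hLM)

/-! ### Quasinormal operators, square roots and unitary extensions -/

theorem isQuasinormalOp_iff {A : H →L[ℂ] H} :
    IsQuasinormalOp A ↔ Commute A (star A * A) := Iff.rfl

theorem isQuasinormalOp_of_isStarNormal {A : H →L[ℂ] H} (hA : IsStarNormal A) :
    IsQuasinormalOp A := by
  have h : Commute A (star A) := hA.star_comm_self.symm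
  exact h.mul_right (Commute.refl A)

theorem isQuasinormalOp_of_isIsometricOp {A : H →L[ℂ] H} (hA : IsIsometricOp A) :
    IsQuasinormalOp A := by
  have h : star A * A = 1 := hA
  rw [isQuasinormalOp_iff, h]
  exact Commute.one_right A

theorem IsQuasinormalOp.star_pow_mul_pow {A : H →L[ℂ] H} (hA : IsQuasinormalOp A) (n : ℕ) :
    star A ^ n * A ^ n = (star A * A) ^ n := by
  rw [isQuasinormalOp_iff] at hA
  induction n with
  | zero => simp
  | succ n ih =>
    rw [pow_succ (star A), pow_succ' A, mul_assoc, ← mul_assoc (star A) A,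
      ← (hA.pow_left n).eq, ← mul_assoc, ih, ← pow_succ]

theorem IsQuasinormalOp.pow {A : H →L[ℂ] H} (hA : IsQuasinormalOp A) (n : ℕ) :
    IsQuasinormalOp (A ^ n) := by
  rw [isQuasinormalOp_iff, star_pow, hA.star_pow_mul_pow n]
  exact (isQuasinormalOp_iff.1 hA).pow_pow n n

theorem adjoint_isometry_apply (J : H →ₗᵢ[ℂ] K) (x : H) :
    adjoint J.toContinuousLinearMap (J x) = x := by
  refine ext_inner_left ℂ fun y => ?_
  rw [adjoint_inner_right]
  exact J.inner_map_map y x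

theorem projOnto_apply (J : H →ₗᵢ[ℂ] K) (x : K) :
    projOnto J x = J (adjoint J.toContinuousLinearMap x) := by
  have hmem : J (adjoint J.toContinuousLinearMap x) ∈ LinearMap.range J.toLinearMap :=
    LinearMap.mem_range_self J.toLinearMap _
  refine (Submodule.eq_starProjection_of_mem_of_inner_eq_zero hmem ?_)
  rintro _ ⟨y, rfl⟩
  have h₁ : inner ℂ (J (adjoint J.toContinuousLinearMap x)) (J y) = inner ℂ x (J y) := by
    rw [J.inner_map_map, adjoint_inner_left]; rfl
  change inner ℂ (x - J (adjoint J.toContinuousLinearMap x)) (J y) = 0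
  rw [inner_sub_left, h₁, sub_self]

/-- For a quasinormal operator, `S* S` extends to `N* N` for each normal extension `N`. -/
theorem IsQuasinormalOp.extends_star_mul_self {J : H →ₗᵢ[ℂ] K} {S : H →L[ℂ] H} {N : K →L[ℂ] K}
    (hS : IsQuasinormalOp S) (hN : IsStarNormal N) (h : Extends J S N) :
    Extends J (star S * S) (star N * N) := by
  -- Quasinormality turns `(S* S)^n` into `S*^n S^n`, and likewise for `N`. The cases `n = 1, 2`
  -- suffice to expand `‖N* N J x - J S* S x‖²` to zero.
  have hinner : ∀ n : ℕ, ∀ x y : H, inner ℂ (((star N * N) ^ n) (J x)) (J y) =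
      inner ℂ (((star S * S) ^ n) x) y := by
    intro n x y
    rw [← hS.star_pow_mul_pow, ← (isQuasinormalOp_of_isStarNormal hN).star_pow_mul_pow,
      ← star_pow, ← star_pow]
    simp only [star_eq_adjoint, mul_apply_eq_comp,
      adjoint_inner_left]
    rw [h.pow n, h.pow n, J.inner_map_map]
  have hN' : ∀ x y : K, inner ℂ ((star N * N) x) y = inner ℂ x ((star N * N) y) :=
    fun x y => (IsSelfAdjoint.star_mul_self N).isSymmetric x y
  have hS' : ∀ x y : H, inner ℂ ((star S * S) x) y = inner ℂ x ((star S * S) y) :=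
    fun x y => (IsSelfAdjoint.star_mul_self S).isSymmetric x y
  intro x
  have e₁ : inner ℂ ((star N * N) (J x)) ((star N * N) (J x)) =
      inner ℂ ((star S * S) x) ((star S * S) x) := by
    have := hinner 2 x x
    rw [pow_two, pow_two] at this
    simp only [mul_apply_eq_comp (f := star N * N), mul_apply_eq_comp (f := star S * S)] at this
    rw [← hN', ← hS']
    exact this
  have e₂ : inner ℂ ((star N * N) (J x)) (J ((star S * S) x)) =
      inner ℂ ((star S * S) x) ((star S * S) x) := by
    simpa using hinner 1 x ((star S * S) x)
  have e₃ : inner ℂ (J ((star S * S) x)) ((star N * N) (J x)) =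
      inner ℂ ((star S * S) x) ((star S * S) x) := by
    rw [← inner_conj_symm, e₂, inner_conj_symm]
  rw [← sub_eq_zero, ← inner_self_eq_zero (𝕜 := ℂ), inner_sub_left, inner_sub_right,
    inner_sub_right, e₁, e₂, e₃, J.inner_map_map]
  ring

/-- Self-adjointness makes the range of `J` reduce `B`, hence also its square root. The compression
of that root to `H` is positive with square `A`, so uniqueness of positive roots applies. -/
theorem Extends.sqrt {J : H →ₗᵢ[ℂ] K} {A : H →L[ℂ] H} {B : K →L[ℂ] K} (hA : 0 ≤ A) (hB : 0 ≤ B)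
    (h : Extends J A B) : Extends J (CFC.sqrt A) (CFC.sqrt B) := by
  set j := J.toContinuousLinearMap
  have hjj : ∀ x, adjoint j (j x) = x := adjoint_isometry_apply J
  have hBj : ∀ x, B (j x) = j (A x) := h
  have hB' : star B = B := hB.isSelfAdjoint.star_eq
  have hA' : star A = A := hA.isSelfAdjoint.star_eq
  have hjB : ∀ x, adjoint j (B x) = A (adjoint j x) := by
    intro x
    refine ext_inner_right ℂ fun y => ?_
    rw [star_eq_adjoint] at hA' hB'
    rw [adjoint_inner_left, ← hB', adjoint_inner_left, hBj, ← hA', adjoint_inner_left,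
      adjoint_inner_left, hA']
  have hcomm : Commute B (j ∘L adjoint j) := by
    ext x
    simp [hBj, hjB]
  have hs : ∀ x, CFC.sqrt B (j (adjoint j x)) = j (adjoint j (CFC.sqrt B x)) := fun x =>
    congrArg (fun C : K →L[ℂ] K => C x) (hcomm.cfcₙ_nnreal NNReal.sqrt).eq
  have hss : ∀ x, CFC.sqrt B (CFC.sqrt B x) = B x := fun x =>
    congrArg (fun C : K →L[ℂ] K => C x) (CFC.sqrt_mul_sqrt_self B hB)
  have hsq : CFC.sqrt A = adjoint j ∘L CFC.sqrt B ∘L j := by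
    refine CFC.sqrt_unique ?_ ?_
    · ext x
      simp [← hs, hss, hjj, hBj]
    · rw [nonneg_iff_isPositive]
      exact ((nonneg_iff_isPositive _).1 (CFC.sqrt_nonneg B)).adjoint_conj j
  intro x
  rw [hsq]
  have := hs (j x)
  rw [hjj] at this
  exact this

theorem adjoint_comp_self_nonneg (E : H →L[ℂ] K) : 0 ≤ adjoint E ∘L E := by
  rw [nonneg_iff_isPositive]
  exact isPositive_adjoint_comp_self E

theorem modulus_mul_modulus (E : H →L[ℂ] K) : modulus E * modulus E = adjoint E ∘L E :=
  CFC.sqrt_mul_sqrt_self _ (adjoint_comp_self_nonneg E)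

theorem Extends.mul {J : H →ₗᵢ[ℂ] K} {A A' : H →L[ℂ] H} {B B' : K →L[ℂ] K} (h : Extends J A B)
    (h' : Extends J A' B') : Extends J (A * A') (B * B') := fun x => by
  simp only [mul_apply_eq_comp, h' x, h _]

theorem Extends.sum {ι : Type*} {J : H →ₗᵢ[ℂ] K} {A : ι → H →L[ℂ] H} {B : ι → K →L[ℂ] K}
    (s : Finset ι) (h : ∀ i, Extends J (A i) (B i)) :
    Extends J (∑ i ∈ s, A i) (∑ i ∈ s, B i) := fun x => by
  simp only [_root_.sum_apply, map_sum, h _ x]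

/-- The kernel of `N* N - 1` is closed, reduces `N` by normality, and contains `H` because `N* N`
extends `S* S = 1`. -/
theorem IsMinNormalExt.isUnitaryOp {J : H →ₗᵢ[ℂ] K} {S : H →L[ℂ] H} {N : K →L[ℂ] K}
    (h : IsMinNormalExt J S N) (hS : IsIsometricOp S) : IsUnitaryOp N := by
  obtain ⟨hN, hext, hmin⟩ := h
  have hS' : star S * S = 1 := hS
  have hc : Commute (star N) N := hN.star_comm_self
  let M : Submodule ℂ K := (star N * N - 1).ker
  have hmem : ∀ x, x ∈ M ↔ (star N * N) x = x := fun x => by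
    simp [M, sub_eq_zero]
  have hMc : IsClosed (M : Set K) := (star N * N - 1).isClosed_ker
  have hinv : ∀ A : K →L[ℂ] K, Commute (star N * N) A → ∀ x ∈ M, A x ∈ M := by
    intro A hA x hx
    rw [hmem] at hx ⊢
    have := congrArg (fun B : K →L[ℂ] K => B x) hA.eq
    exact this.trans (congrArg A hx)
  have htop : M = ⊤ := by
    refine hmin M hMc ?_ ((reduces_iff hMc N).2
      ⟨hinv N (hc.mul_left (Commute.refl N)), hinv (star N) ((Commute.refl _).mul_left hc.symm)⟩)
    rintro _ ⟨x, rfl⟩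
    rw [hmem]
    have := (isQuasinormalOp_of_isIsometricOp hS).extends_star_mul_self hN hext x
    rw [hS'] at this
    exact this
  have h₁ : star N * N = 1 := by
    ext x
    exact (hmem x).1 (htop ▸ Submodule.mem_top)
  exact ⟨h₁, hc.eq.symm.trans h₁⟩

theorem IsUnitaryOp.pow {A : H →L[ℂ] H} (hA : IsUnitaryOp A) (n : ℕ) : IsUnitaryOp (A ^ n) := by
  have h : A ∈ unitary (H →L[ℂ] H) := hA
  exact pow_mem h n

end Operators

/-! ### Powers of Brownian-type block operators -/

section Block

variable {H₁ H₂ : Type*} [NormedAddCommGroup H₁] [InnerProductSpace ℂ H₁] [CompleteSpace H₁]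
  [NormedAddCommGroup H₂] [InnerProductSpace ℂ H₂] [CompleteSpace H₂]

theorem block_apply (A : H₁ →L[ℂ] H₁) (B : H₂ →L[ℂ] H₁) (C : H₁ →L[ℂ] H₂) (D : H₂ →L[ℂ] H₂)
    (x : WithLp 2 (H₁ × H₂)) :
    block A B C D x = WithLp.toLp 2 (A x.fst + B x.snd, C x.fst + D x.snd) := rfl

/-- Identifies the entries hidden in the existential definitions with the given ones. -/
theorem block_injective {A A' : H₁ →L[ℂ] H₁} {B B' : H₂ →L[ℂ] H₁} {C C' : H₁ →L[ℂ] H₂}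
    {D D' : H₂ →L[ℂ] H₂} (h : block A B C D = block A' B' C' D') :
    A = A' ∧ B = B' ∧ C = C' ∧ D = D' := by
  have key : ∀ (x : H₁) (y : H₂), A x + B y = A' x + B' y ∧ C x + D y = C' x + D' y := by
    intro x y
    have := congrArg (fun F : WithLp 2 (H₁ × H₂) →L[ℂ] WithLp 2 (H₁ × H₂) =>
      WithLp.ofLp (F (WithLp.toLp 2 (x, y)))) h
    simpa [block_apply] using this
  refine ⟨?_, ?_, ?_, ?_⟩ <;> ext x
  · simpa using (key x 0).1
  · simpa using (key 0 x).1
  · simpa using (key x 0).2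
  · simpa using (key 0 x).2

theorem isOfClass_block_iff {𝒳 : (H₂ →L[ℂ] H₂) → Prop} {V : H₁ →L[ℂ] H₁} {E : H₂ →L[ℂ] H₁}
    {X : H₂ →L[ℂ] H₂} : IsOfClass 𝒳 (block V E 0 X) ↔ IsBrownianType V E X ∧ 𝒳 X := by
  constructor
  · rintro ⟨V', E', X', h, hB, hX⟩
    obtain ⟨rfl, rfl, -, rfl⟩ := block_injective h
    exact ⟨hB, hX⟩
  · rintro ⟨hB, hX⟩
    exact ⟨V, E, X, rfl, hB, hX⟩

/-- The term `j = 0` is split off; every other term has a left factor `V`. -/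
theorem powEntry_succ (V : H₁ →L[ℂ] H₁) (E : H₂ →L[ℂ] H₁) (S : H₂ →L[ℂ] H₂) (n : ℕ) :
    powEntry V E S (n + 1) = E ∘L S ^ n + V ∘L powEntry V E S n := by
  rw [powEntry, Finset.sum_range_succ', add_comm]
  congr 1
  ext x
  simp only [powEntry, _root_.sum_apply, ContinuousLinearMap.comp_apply, map_sum,
    pow_succ', mul_apply_eq_comp]
  refine Finset.sum_congr rfl fun j _ => ?_
  rw [show n + 1 - 1 - (j + 1) = n - 1 - j by omega]

theorem block_pow (V : H₁ →L[ℂ] H₁) (E : H₂ →L[ℂ] H₁) (S : H₂ →L[ℂ] H₂) (n : ℕ) :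
    block V E 0 S ^ n = block (V ^ n) (powEntry V E S n) 0 (S ^ n) := by
  induction n with
  | zero =>
    ext x
    simp only [block_apply, powEntry, pow_zero, Finset.range_zero, Finset.sum_empty, one_apply_eq_self,
      _root_.zero_apply, add_zero, zero_add]
    rfl
  | succ n ih =>
    rw [pow_succ', ih]
    ext x; simp [block_apply, powEntry_succ, pow_succ', add_assoc, add_comm]

variable {V : H₁ →L[ℂ] H₁} {E : H₂ →L[ℂ] H₁} {X : H₂ →L[ℂ] H₂}

theorem IsBrownianType.adjoint_pow_comp_powEntry (h : IsBrownianType V E X) (n : ℕ) :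
    adjoint (V ^ n) ∘L powEntry V E X n = 0 := by
  have hV : ∀ x, adjoint V (V x) = x := fun x => congrArg (fun B : H₁ →L[ℂ] H₁ => B x) h.isometry
  have hE : ∀ x, adjoint V (E x) = 0 := fun x =>
    congrArg (fun B : H₂ →L[ℂ] H₁ => B x) h.adjoint_comp
  induction n with
  | zero => simp [powEntry]
  | succ n ih =>
    ext x
    have hx : adjoint (V ^ n) (powEntry V E X n x) = 0 :=
      congrArg (fun B : H₂ →L[ℂ] H₁ => B x) ih
    have : adjoint (V ^ (n + 1)) = adjoint (V ^ n) ∘L adjoint V := by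
      rw [pow_succ']; exact ContinuousLinearMap.adjoint_comp V (V ^ n)
    simp [this, powEntry_succ, hV, hE, hx]

theorem IsBrownianType.adjoint_powEntry_comp_powEntry (h : IsBrownianType V E X)
    (hX : IsQuasinormalOp X) (n : ℕ) :
    adjoint (powEntry V E X n) ∘L powEntry V E X n =
      ∑ j ∈ Finset.range n, (star X * X) ^ j * (adjoint E ∘L E) := by
  have hV : ∀ x, adjoint V (V x) = x := fun x => congrArg (fun B : H₁ →L[ℂ] H₁ => B x) h.isometry
  have hE : ∀ x, adjoint V (E x) = 0 := fun x =>
    congrArg (fun B : H₂ →L[ℂ] H₁ => B x) h.adjoint_comp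
  have hE' : ∀ x, adjoint E (V x) = 0 := fun x => by
    refine ext_inner_right ℂ fun y => ?_
    rw [adjoint_inner_left, ← adjoint_inner_right, hE, inner_zero_right, inner_zero_left]
  induction n with
  | zero => simp [powEntry]
  | succ n ih =>
    have hc : Commute X (adjoint E ∘L E) := h.comm
    -- This is the new summand `(E X^n)* (E X^n)`; the cross terms vanish by `hE` and `hE'`.
    have e : (star X * X) ^ n * (adjoint E ∘L E) =
        adjoint (X ^ n) * ((adjoint E ∘L E) * X ^ n) := by
      rw [← hX.star_pow_mul_pow, ← star_eq_adjoint (X ^ n), star_pow, mul_assoc, (hc.pow_left n).eq]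
    rw [Finset.sum_range_succ, ← ih, e]
    ext x
    simp [powEntry_succ, hV, hE, hE', ContinuousLinearMap.adjoint_comp, add_comm]

theorem IsBrownianType.pow (h : IsBrownianType V E X) (hX : IsQuasinormalOp X) (n : ℕ) :
    IsBrownianType (V ^ n) (powEntry V E X n) (X ^ n) where
  nontrivial_left := h.nontrivial_left
  nontrivial_right := h.nontrivial_right
  isometry := by
    have hV : star V * V = 1 := h.isometry
    change star (V ^ n) * V ^ n = 1
    rw [star_pow]
    exact pow_mul_pow_eq_one n hV
  adjoint_comp := h.adjoint_pow_comp_powEntry n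
  comm := by
    have hc : Commute X (adjoint E ∘L E) := h.comm
    rw [h.adjoint_powEntry_comp_powEntry hX]
    exact (Commute.sum_right _ _ _ fun j _ =>
      ((isQuasinormalOp_iff.1 hX).pow_right j).mul_right hc).pow_left n

end Block

/-! ### Entrywise extensions -/

section Extension

variable {H₁ H₂ K₁ K₂ : Type*}
  [NormedAddCommGroup H₁] [InnerProductSpace ℂ H₁] [CompleteSpace H₁]
  [NormedAddCommGroup H₂] [InnerProductSpace ℂ H₂] [CompleteSpace H₂]
  [NormedAddCommGroup K₁] [InnerProductSpace ℂ K₁] [CompleteSpace K₁]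
  [NormedAddCommGroup K₂] [InnerProductSpace ℂ K₂] [CompleteSpace K₂]
  {J₁ : H₁ →ₗᵢ[ℂ] K₁} {J₂ : H₂ →ₗᵢ[ℂ] K₂}
  {V : H₁ →L[ℂ] H₁} {E : H₂ →L[ℂ] H₁} {S : H₂ →L[ℂ] H₂}
  {V' : K₁ →L[ℂ] K₁} {E' : K₂ →L[ℂ] K₁} {N : K₂ →L[ℂ] K₂}

theorem powEntry_extends (hV : Extends J₁ V V') (hE : ∀ h, E' (J₂ h) = J₁ (E h))
    (hS : Extends J₂ S N) (n : ℕ) (h : H₂) :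
    powEntry V' E' N n (J₂ h) = J₁ (powEntry V E S n h) := by
  simp only [powEntry, _root_.sum_apply, ContinuousLinearMap.comp_apply, map_sum,
    (hS.pow _) _, hE, (hV.pow _) _]

/-- From `F' J₂ = J₁ F` and `J₁* J₁ = 1`, one gets `J₂* F'* F' J₂ = F* F`, while the projection is
`J₂ J₂*`. -/
theorem compression_adjoint_comp_self {F : H₂ →L[ℂ] H₁} {F' : K₂ →L[ℂ] K₁}
    (hF : ∀ h, F' (J₂ h) = J₁ (F h)) (h : H₂) :
    J₂ ((adjoint F ∘L F) h) = projOnto J₂ ((adjoint F' ∘L F') (J₂ h)) := by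
  rw [projOnto_apply]
  congr 1
  refine ext_inner_right ℂ fun y => ?_
  rw [adjoint_inner_left]
  change inner ℂ (adjoint F (F h)) y = inner ℂ (adjoint F' (F' (J₂ h))) (J₂ y)
  rw [adjoint_inner_left, adjoint_inner_left, hF, hF, J₁.inner_map_map]

theorem modulus_powEntry_extends (hB : IsBrownianType V E S) (hB' : IsBrownianType V' E' N)
    (hSq : IsQuasinormalOp S) (hN : IsStarNormal N) (hS : Extends J₂ S N)
    (hmod : Extends J₂ (modulus E) (modulus E')) (n : ℕ) :
    Extends J₂ (modulus (powEntry V E S n)) (modulus (powEntry V' E' N n)) := by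
  refine Extends.sqrt (adjoint_comp_self_nonneg _) (adjoint_comp_self_nonneg _) ?_
  rw [hB.adjoint_powEntry_comp_powEntry hSq,
    hB'.adjoint_powEntry_comp_powEntry (isQuasinormalOp_of_isStarNormal hN),
    ← modulus_mul_modulus, ← modulus_mul_modulus]
  exact Extends.sum _ fun j => ((hSq.extends_star_mul_self hN hS).pow j).mul (hmod.mul hmod)

end Extension

end Brownian

theorem proposition3p11
    {H₁ H₂ K₁ K₂ : Type*}
    [NormedAddCommGroup H₁] [InnerProductSpace ℂ H₁] [CompleteSpace H₁]
    [NormedAddCommGroup H₂] [InnerProductSpace ℂ H₂] [CompleteSpace H₂]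
    [NormedAddCommGroup K₁] [InnerProductSpace ℂ K₁] [CompleteSpace K₁]
    [NormedAddCommGroup K₂] [InnerProductSpace ℂ K₂] [CompleteSpace K₂]
    (J₁ : H₁ →ₗᵢ[ℂ] K₁) (J₂ : H₂ →ₗᵢ[ℂ] K₂)
    (V : H₁ →L[ℂ] H₁) (E : H₂ →L[ℂ] H₁) (S : H₂ →L[ℂ] H₂)
    (V' : K₁ →L[ℂ] K₁) (E' : K₂ →L[ℂ] K₁) (N : K₂ →L[ℂ] K₂)
    (T : WithLp 2 (H₁ × H₂) →L[ℂ] WithLp 2 (H₁ × H₂))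
    (R : WithLp 2 (K₁ × K₂) →L[ℂ] WithLp 2 (K₁ × K₂))
    (hT : T = Brownian.block V E 0 S)
    (hR : R = Brownian.block V' E' 0 N)
    (hTS : Brownian.IsOfClass Brownian.IsSubnormalOp T)
    (hRN : Brownian.IsOfClass Brownian.IsNormalOp R)
    (hTR : Brownian.EntrywiseExtends J₁ J₂ T R)
    (n : ℕ) (hn : 1 ≤ n) :
    -- powers and their entries
    (T ^ n = Brownian.block (V ^ n) (Brownian.powEntry V E S n) 0 (S ^ n) ∧
      R ^ n = Brownian.block (V' ^ n) (Brownian.powEntry V' E' N n) 0 (N ^ n) ∧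
      Brownian.EntrywiseExtends J₁ J₂ (T ^ n) (R ^ n) ∧
      Brownian.IsOfClass Brownian.IsNormalOp (R ^ n)) ∧
    -- compression
    (Brownian.Extends J₂ (Brownian.modulus E) (Brownian.modulus E') →
      ∀ h : H₂,
        J₂ ((ContinuousLinearMap.adjoint (Brownian.powEntry V E S n) ∘L
            Brownian.powEntry V E S n) h) =
          Brownian.projOnto J₂
            ((ContinuousLinearMap.adjoint (Brownian.powEntry V' E' N n) ∘L
              Brownian.powEntry V' E' N n) (J₂ h))) ∧
    -- minimal normal extensions
    (Brownian.IsMinNormalExt J₂ S N → Brownian.IsMinNormalExt J₂ (S ^ n) (N ^ n)) ∧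
    -- the quasinormal class
    (Brownian.IsOfClass Brownian.IsQuasinormalOp T →
      Brownian.Extends J₂ (Brownian.modulus E) (Brownian.modulus E') →
        Brownian.IsOfClass Brownian.IsQuasinormalOp (T ^ n) ∧
        Brownian.EntrywiseExtends J₁ J₂ (T ^ n) (R ^ n) ∧
        Brownian.IsOfClass Brownian.IsNormalOp (R ^ n) ∧
        Brownian.Extends J₂ (Brownian.modulus (Brownian.powEntry V E S n))
          (Brownian.modulus (Brownian.powEntry V' E' N n))) ∧
    -- the isometric class
    (Brownian.IsOfClass Brownian.IsIsometricOp T →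
      Brownian.IsMinNormalExt J₂ S N →
        Brownian.IsOfClass Brownian.IsUnitaryOp (R ^ n) ∧
        Brownian.IsMinNormalExt J₂ (S ^ n) (N ^ n)) := by
  subst hT hR
  obtain ⟨A₁₁, A₁₂, A₂₁, A₂₂, B₁₁, B₁₂, B₂₁, B₂₂, hA, hB, hV, hE, -, hS⟩ := hTR
  obtain ⟨rfl, rfl, -, rfl⟩ := Brownian.block_injective hA
  obtain ⟨rfl, rfl, -, rfl⟩ := Brownian.block_injective hB
  rw [Brownian.isOfClass_block_iff] at hTS hRN
  obtain ⟨hRB, hN⟩ := hRN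
  have hn₀ : n ≠ 0 := by omega
  have hext := Brownian.powEntry_extends hV hE hS n
  have hRBn := hRB.pow (Brownian.isQuasinormalOp_of_isStarNormal hN) n
  simp only [Brownian.block_pow, Brownian.isOfClass_block_iff]
  have hprec : Brownian.EntrywiseExtends J₁ J₂
      (Brownian.block (V ^ n) (Brownian.powEntry V E S n) 0 (S ^ n))
      (Brownian.block (V' ^ n) (Brownian.powEntry V' E' N n) 0 (N ^ n)) :=
    ⟨_, _, _, _, _, _, _, _, rfl, rfl, Brownian.Extends.pow hV n, hext, fun _ => by simp,
      Brownian.Extends.pow hS n⟩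
  have hnormal := Brownian.isStarNormal_pow hN n
  refine ⟨⟨trivial, trivial, hprec, hRBn, hnormal⟩,
    fun _ => Brownian.compression_adjoint_comp_self hext, fun h => h.pow hn₀, ?_, ?_⟩
  · rintro ⟨hTB, hSq⟩ hmod
    exact ⟨⟨hTB.pow hSq n, hSq.pow n⟩, hprec, ⟨hRBn, hnormal⟩,
      Brownian.modulus_powEntry_extends hTB hRB hSq hN hS hmod n⟩
  · rintro ⟨-, hSi⟩ h
    exact ⟨⟨hRBn, (h.isUnitaryOp hSi).pow n⟩, h.pow hn₀⟩
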